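/- Let $n\ge 0$, let $\mathbb K$ be a field, and let $\Sigma=(\sigma_{ij})$ be the generic symmetric $n\times n$ matrix, whose entries $\sigma_{ij}=\sigma_{ji}$ ($i\le j$) are the variables of the polynomial ring $\mathbb K[\Sigma]$. For $w\in S_n$ let $P(w)$ be the $n\times n$ matrix with a $1$ in position $(i,j)$ if $n+1-w(i)=j$ and $0$ otherwise, let $R(w)_{ij}=\sum_{k\le i}\sum_{l\ge j}P(w)_{kl}$, and define the symmetric Schubert determinantal ideal $$J_{\rm sym}(w)=\sum_{i,j}\big\langle (R(w)_{ij}+1)\text{-minors of }\Sigma_{[1,i],[j,n]}\big\rangle\subseteq\mathbb K[\Sigma].$$ For pairwise disjoint $A,B,C\subseteq[n]$, the conditional independence (CI) ideal is $J_{A\perp B\mid C}=\langle(\#C+1)\text{-minors of }\Sigma_{A\cup C,B\cup C}\rangle\subseteq\mathbb K[\Sigma]$. A Schubert CI ideal is an ideal of $\mathbb K[\Sigma]$ that is both a CI ideal and equal to $J_{\rm sym}(v)$ for some $v\in S_n$. The diagram of $w$ is the set of boxes $(i,j)\in[n]\times[n]$ such that $P(w)$ has no $1$ in column $j$ in rows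 $1,\dots,i$ and no $1$ in row $i$ in columns $j,\dots,n$. The essential set $\mathcal Ess(w)$ is the set of those $(i,j)$ in the diagram such that neither $(i+1,j)$ nor $(i,j-1)$ is in the diagram. The permutation $w$ is defined by inclusions if for every $(i,j)\in\mathcal Ess(w)$ either there are no $1$s of $P(w)$ weakly North-East of $(i,j)$ (in a position $(k,l)$ with $k\le i$, $l\ge j$), or there are no $1$s of $P(w)$ strictly South-West of $(i,j)$ (in a position $(k,l)$ with $k>i$, $l<j$). Proposition. For every $w\in S_n$, the ideal $J_{\rm sym}(w)$ is a finite (possibly empty) sum of Schubert CI ideals if and only if $w$ is defined by inclusions. -/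

import Mathlib

namespace SymSchubert

open MvPolynomial

/-- The matrix `P(w)`: it has a `1` in position `(i, j)` if and only if `w₀ w (i) = j`, where the
longest permutation `w₀` is the order reversal `Fin.rev`. Indices are `0`-based. -/
def permMat {n : ℕ} (w : Equiv.Perm (Fin n)) : Matrix (Fin n) (Fin n) ℕ :=
  Matrix.of fun i j => if Fin.rev (w i) = j then 1 else 0

/-- The rank matrix `R(w)`: the number of `1`s of `P(w)` weakly North-East of `(i, j)`. -/
def rankMat {n : ℕ} (w : Equiv.Perm (Fin n)) (i j : Fin n) : ℕ :=
  ∑ k ∈ Finset.Iic i, ∑ l ∈ Finset.Ici j, permMat w k l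

/-- The diagram of `w`: the boxes left over when every `1` of `P(w)` crosses out its own box and
all boxes South and West of it. -/
def diagram {n : ℕ} (w : Equiv.Perm (Fin n)) : Set (Fin n × Fin n) :=
  {p | (∀ k ≤ p.1, permMat w k p.2 ≠ 1) ∧ (∀ l ≥ p.2, permMat w p.1 l ≠ 1)}

/-- Fulton's essential set: the South-West corners of the diagram. Boxes outside of the grid do
not belong to the diagram. -/
def essentialSet {n : ℕ} (w : Equiv.Perm (Fin n)) : Set (Fin n × Fin n) :=
  {p | p ∈ diagram w ∧
    (∀ i' : Fin n, (i' : ℕ) = (p.1 : ℕ) + 1 → (i', p.2) ∉ diagram w) ∧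
    (∀ j' : Fin n, (j' : ℕ) + 1 = (p.2 : ℕ) → (p.1, j') ∉ diagram w)}

/-- `w` is defined by inclusions: at each essential box there are no `1`s of `P(w)` weakly
North-East of the box, or there are no `1`s of `P(w)` strictly South-West of the box. -/
def DefinedByInclusions {n : ℕ} (w : Equiv.Perm (Fin n)) : Prop :=
  ∀ p ∈ essentialSet w,
    (∀ k ≤ p.1, ∀ l ≥ p.2, permMat w k l ≠ 1) ∨
    (∀ k > p.1, ∀ l < p.2, permMat w k l ≠ 1)

/-- The ideal generated by the minors of size `k` of the submatrix of `M` with row set `I` and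
column set `L`. -/
def minorIdeal {n : ℕ} {R : Type*} [CommRing R] (M : Matrix (Fin n) (Fin n) R) (k : ℕ)
    (I L : Finset (Fin n)) : Ideal R :=
  Ideal.span {d | ∃ f g : Fin k ↪o Fin n,
    (∀ t, f t ∈ I) ∧ (∀ t, g t ∈ L) ∧ d = (M.submatrix f g).det}

/-- The polynomial ring `K[Σ]`, with one variable for each unordered pair of indices. -/
abbrev SymRing (K : Type*) [Field K] (n : ℕ) := MvPolynomial (Sym2 (Fin n)) K

/-- The generic symmetric `n × n` matrix `Σ`. -/
noncomputable def genericSym (K : Type*) [Field K] (n : ℕ) :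
    Matrix (Fin n) (Fin n) (SymRing K n) :=
  Matrix.of fun i j => X s(i, j)

/-- The symmetric Schubert determinantal ideal `J_sym(w)`: the sum over all `(i, j)` of the ideals
of minors of size `R(w)_{ij} + 1` of `Σ_{[1,i],[j,n]}`. -/
noncomputable def Jsym (K : Type*) [Field K] {n : ℕ} (w : Equiv.Perm (Fin n)) :
    Ideal (SymRing K n) :=
  ⨆ i : Fin n, ⨆ j : Fin n,
    minorIdeal (genericSym K n) (rankMat w i j + 1) (Finset.Iic i) (Finset.Ici j)

/-- The conditional independence ideal of `A ⊥ B | C`. -/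
noncomputable def ciIdeal (K : Type*) [Field K] {n : ℕ} (A B C : Finset (Fin n)) :
    Ideal (SymRing K n) :=
  minorIdeal (genericSym K n) (C.card + 1) (A ∪ C) (B ∪ C)

/-- A Schubert conditional independence ideal is an ideal that is both a symmetric Schubert
determinantal ideal and a conditional independence ideal. -/
def IsSchubertCI {K : Type*} [Field K] {n : ℕ} (I : Ideal (SymRing K n)) : Prop :=
  (∃ v : Equiv.Perm (Fin n), I = Jsym K v) ∧
  (∃ A B C : Finset (Fin n), Disjoint A B ∧ Disjoint A C ∧ Disjoint B C ∧ I = ciIdeal K A B C)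

/-- A finite (possibly empty) sum of Schubert conditional independence ideals. -/
def IsSumOfSchubertCI {K : Type*} [Field K] {n : ℕ} (I : Ideal (SymRing K n)) : Prop :=
  ∃ s : Finset (Ideal (SymRing K n)), (∀ J ∈ s, IsSchubertCI J) ∧ I = ∑ J ∈ s, J

end SymSchubert

/-! Write `R` for `rankMat w`, with `0`-based indices. Counting the `1`s in the rows up to `i` and
in the columns before `j` gives `R i j + j = i + 1 + #SW` (`rankMat_add`). So one of the two
inclusion conditions holds at a box exactly when `R i j` is the truncated difference `i + 1 - j`,
its least possible value and the cardinality of `[j, i]`.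

If `w` is defined by inclusions, Fulton's reduction to essential boxes (`Jsym_le_of_essentialSet`)
writes `Jsym K w` as a sum of box ideals. At least rank, a box ideal is the CI ideal with `C = [j,
i]`, and it is also `Jsym` of a bigrassmannian permutation (`isSchubertCI_boxIdeal`).

Conversely, let both conditions fail at an essential box `(i, j)`. Some `w'` has rank one higher
there and nowhere else higher (`exists_rankMat_succ`). An explicit symmetric matrix over `K[X]` has
exactly the North-East ranks of `w'`, so `Jsym K v` vanishes at it if and only if `R(w') ≤ R(v)`
(`Jsym_le_ker_genericPoint_iff`). Hence `Jsym K w` does not vanish there, and neither does some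
summand `Jsym K v = ciIdeal K A B C`; comparing ranks, `R(v)` agrees with `R(w)` at `(i, j)`, so it
is not least there. But being a CI ideal forces, for all `a ∈ A` and `b ∈ B`, a box of `v` of least
rank with `C = [j', i']` and with `a`, `b` on opposite sides (`exists_box_of_Jsym_eq_ciIdeal`).
These boxes are not `(i, j)`, so the matrix of `w'` satisfies their conditions, which already make
the CI minors vanish (`minorIdeal_eq_bot_of_boxes`): a contradiction. Ideals are only tested at
single points, so neither primality nor radicality is needed. -/

namespace SymSchubert

/-! ### Ideals of minors -/

section MinorIdeal

variable {R : Type*} [CommRing R] {n : ℕ}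

theorem minorIdeal_mono (M : Matrix (Fin n) (Fin n) R) (k : ℕ) {I I' L L' : Finset (Fin n)}
    (hI : I ⊆ I') (hL : L ⊆ L') : minorIdeal M k I L ≤ minorIdeal M k I' L' := by
  refine Ideal.span_mono ?_
  rintro d ⟨f, g, hf, hg, rfl⟩
  exact ⟨f, g, fun t => hI (hf t), fun t => hL (hg t), rfl⟩

theorem minorIdeal_eq_bot_iff (M : Matrix (Fin n) (Fin n) R) (k : ℕ) (I L : Finset (Fin n)) :
    minorIdeal M k I L = ⊥ ↔ ∀ f g : Fin k ↪o Fin n, (∀ t, f t ∈ I) → (∀ t, g t ∈ L) →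
      (M.submatrix f g).det = 0 := by
  rw [minorIdeal, Ideal.span_eq_bot]
  constructor
  · intro h f g hf hg
    exact h _ ⟨f, g, hf, hg, rfl⟩
  · rintro h d ⟨f, g, hf, hg, rfl⟩
    exact h f g hf hg

/-- A repeated row or column gives determinant zero, and sorting distinct ones only changes the
sign. This frees later arguments from increasing index selections. -/
theorem det_submatrix_mem_minorIdeal {ι : Type*} [Fintype ι] [DecidableEq ι]
    (M : Matrix (Fin n) (Fin n) R) {k : ℕ} {I L : Finset (Fin n)} (hk : Fintype.card ι = k)
    {f g : ι → Fin n} (hf : ∀ t, f t ∈ I) (hg : ∀ t, g t ∈ L) :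
    (M.submatrix f g).det ∈ minorIdeal M k I L := by
  have e : Fin k ≃ ι := (Fintype.equivFinOfCardEq hk).symm
  rw [← Matrix.det_submatrix_equiv_self e, Matrix.submatrix_submatrix]
  have hf' : ∀ t, (f ∘ e) t ∈ I := fun t => hf _
  have hg' : ∀ t, (g ∘ e) t ∈ L := fun t => hg _
  generalize f ∘ e = f at hf'
  generalize g ∘ e = g at hg'
  by_cases hfi : Function.Injective f
  swap
  · obtain ⟨a, b, hab, hne⟩ := Function.not_injective_iff.1 hfi
    rw [Matrix.det_zero_of_row_eq hne (by ext; simp [hab])]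
    exact zero_mem _
  by_cases hgi : Function.Injective g
  swap
  · obtain ⟨a, b, hab, hne⟩ := Function.not_injective_iff.1 hgi
    rw [Matrix.det_zero_of_column_eq hne (by simp [hab])]
    exact zero_mem _
  have hfs : StrictMono (f ∘ Tuple.sort f) :=
    (Tuple.monotone_sort f).strictMono_of_injective (hfi.comp (Equiv.injective _))
  have hgs : StrictMono (g ∘ Tuple.sort g) :=
    (Tuple.monotone_sort g).strictMono_of_injective (hgi.comp (Equiv.injective _))
  have key : M.submatrix f g =
      ((M.submatrix (OrderEmbedding.ofStrictMono _ hfs) (OrderEmbedding.ofStrictMono _ hgs)).submatrix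
        id (Tuple.sort g).symm).submatrix (Tuple.sort f).symm id := by
    ext; simp
  rw [key, Matrix.det_permute, Matrix.det_permute']
  refine Ideal.mul_mem_left _ _ (Ideal.mul_mem_left _ _ (Ideal.subset_span ?_))
  exact ⟨_, _, fun t => hf' _, fun t => hg' _, rfl⟩

theorem minorIdeal_transpose (M : Matrix (Fin n) (Fin n) R) (k : ℕ) (I L : Finset (Fin n)) :
    minorIdeal M.transpose k I L = minorIdeal M k L I := by
  unfold minorIdeal
  congr 1
  ext d
  constructor <;>
  · rintro ⟨f, g, hf, hg, rfl⟩
    exact ⟨g, f, hg, hf, by rw [← Matrix.det_transpose]; rfl⟩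

/-- Laplace expansion along a column. -/
theorem minorIdeal_succ_le_erase_right (M : Matrix (Fin n) (Fin n) R) (k : ℕ)
    (I L : Finset (Fin n)) (j : Fin n) :
    minorIdeal M (k + 1) I L ≤ minorIdeal M k I (L.erase j) := by
  refine Ideal.span_le.2 ?_
  rintro d ⟨f, g, hf, hg, rfl⟩
  -- Expand along column `j` if the minor uses it; otherwise any column will do.
  obtain ⟨t, ht⟩ : ∃ t, ∀ s, g (Fin.succAbove t s) ≠ j := by
    by_cases h : ∃ t, g t = j
    · obtain ⟨t, rfl⟩ := h
      exact ⟨t, fun s hs => Fin.succAbove_ne t s (g.injective hs)⟩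
    · exact ⟨0, fun s hs => h ⟨_, hs⟩⟩
  rw [SetLike.mem_coe, Matrix.det_succ_column _ t]
  refine Ideal.sum_mem _ fun s _ => Ideal.mul_mem_left _ _ ?_
  rw [Matrix.submatrix_submatrix]
  exact det_submatrix_mem_minorIdeal M (by simp) (fun _ => hf _)
    fun s => Finset.mem_erase.2 ⟨ht s, hg _⟩

/-- Laplace expansion along a row. -/
theorem minorIdeal_succ_le_erase_left (M : Matrix (Fin n) (Fin n) R) (k : ℕ)
    (I L : Finset (Fin n)) (i : Fin n) :
    minorIdeal M (k + 1) I L ≤ minorIdeal M k (I.erase i) L := by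
  rw [← minorIdeal_transpose, ← minorIdeal_transpose M k]
  exact minorIdeal_succ_le_erase_right _ _ _ _ _

theorem minorIdeal_antitone (M : Matrix (Fin n) (Fin n) R) (I L : Finset (Fin n)) :
    Antitone fun k => minorIdeal M k I L := by
  refine antitone_nat_of_succ_le fun k => ?_
  by_cases hn : Nonempty (Fin n)
  · obtain ⟨j⟩ := hn
    exact (minorIdeal_succ_le_erase_right M k I L j).trans
      (minorIdeal_mono _ _ subset_rfl (Finset.erase_subset _ _))
  · refine Ideal.span_le.2 ?_
    rintro d ⟨f, -⟩
    exact (hn ⟨f 0⟩).elim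

theorem minorIdeal_eq_bot_of_card_lt (M : Matrix (Fin n) (Fin n) R) {k : ℕ}
    {I : Finset (Fin n)} (L : Finset (Fin n)) (h : I.card < k) : minorIdeal M k I L = ⊥ := by
  rw [minorIdeal_eq_bot_iff]
  intro f g hf
  have := Finset.card_le_card_of_injOn f (s := Finset.univ) (t := I) (fun t _ => hf t)
    f.injective.injOn
  simp at this
  omega

/-- Minors of a product are combinations of minors of the second factor. -/
theorem minorIdeal_mul_le (A B : Matrix (Fin n) (Fin n) R) (k : ℕ) {I I' : Finset (Fin n)}
    (L : Finset (Fin n)) (hA : ∀ x ∈ I, ∀ y ∉ I', A x y = 0) :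
    minorIdeal (A * B) k I L ≤ minorIdeal B k I' L := by
  refine Ideal.span_le.2 ?_
  rintro d ⟨f, g, hf, hg, rfl⟩
  -- Each row of the product is a combination of rows of `B`; expand multilinearly over all choices
  -- `h`, repetitions included.
  have key : ((A * B).submatrix f g).det =
      ∑ h : Fin k → Fin n, (∏ t, A (f t) (h t)) * (B.submatrix h g).det := by
    have h1 : (A * B).submatrix f g = fun t => ∑ y, A (f t) y • fun s => B y (g s) := by
      ext t s
      simp [Matrix.mul_apply]
    change Matrix.detRowAlternating.toMultilinearMap _ = _
    rw [h1, MultilinearMap.map_sum]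
    refine Finset.sum_congr rfl fun h _ => ?_
    rw [MultilinearMap.map_smul_univ]
    rfl
  rw [SetLike.mem_coe, key]
  refine Ideal.sum_mem _ fun h _ => ?_
  by_cases hh : ∀ t, h t ∈ I'
  · exact Ideal.mul_mem_left _ _ (det_submatrix_mem_minorIdeal B (by simp) hh hg)
  · push Not at hh
    obtain ⟨t, ht⟩ := hh
    rw [Finset.prod_eq_zero (Finset.mem_univ t) (hA _ (hf t) _ ht), zero_mul]
    exact zero_mem _

theorem map_minorIdeal {S : Type*} [CommRing S] (φ : R →+* S) (M : Matrix (Fin n) (Fin n) R)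
    (k : ℕ) (I L : Finset (Fin n)) :
    (minorIdeal M k I L).map φ = minorIdeal (M.map φ) k I L := by
  rw [minorIdeal, Ideal.map_span, minorIdeal]
  congr 1
  ext d
  constructor
  · rintro ⟨_, ⟨f, g, hf, hg, rfl⟩, rfl⟩
    exact ⟨f, g, hf, hg, by rw [RingHom.map_det]; rfl⟩
  · rintro ⟨f, g, hf, hg, rfl⟩
    exact ⟨_, ⟨f, g, hf, hg, rfl⟩, by rw [RingHom.map_det]; rfl⟩

/-- Minors of size `k` of `a • M` are divisible by `a ^ k`. -/
theorem minorIdeal_smul_le (M : Matrix (Fin n) (Fin n) R) (a : R) (k : ℕ)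
    (I L : Finset (Fin n)) : minorIdeal (a • M) k I L ≤ Ideal.span {a ^ k} := by
  refine Ideal.span_le.2 ?_
  rintro d ⟨f, g, -, -, rfl⟩
  rw [SetLike.mem_coe, show (a • M).submatrix f g = a • M.submatrix f g from rfl,
    Matrix.det_smul, Fintype.card_fin]
  exact Ideal.mul_mem_right _ _ (Ideal.mem_span_singleton_self _)

/-- A lower unitriangular factor on the left does not change the ideals of minors of the
North-East submatrices. -/
theorem minorIdeal_unitriangular_mul {b : Matrix (Fin n) (Fin n) R}
    (hb : ∀ x y, x < y → b x y = 0) (hb1 : ∀ x, b x x = 1) (D : Matrix (Fin n) (Fin n) R) (k : ℕ)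
    (i : Fin n) (L : Finset (Fin n)) :
    minorIdeal (b * D) k (Finset.Iic i) L = minorIdeal D k (Finset.Iic i) L := by
  have low : ∀ c : Matrix (Fin n) (Fin n) R, (∀ x y, x < y → c x y = 0) →
      ∀ x ∈ Finset.Iic i, ∀ y ∉ Finset.Iic i, c x y = 0 := by
    intro c hc x hx y hy
    simp only [Finset.mem_Iic, not_le] at hx hy
    exact hc x y (hx.trans_lt hy)
  have hbt : b.BlockTriangular OrderDual.toDual := fun x y h => hb x y h
  have hdet : b.det = 1 := by
    rw [Matrix.det_of_isLowerTriangular b hbt]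
    simp [hb1]
  have : Invertible b := b.invertibleOfIsUnitDet (by rw [hdet]; exact isUnit_one)
  have hinv := Matrix.blockTriangular_inv_of_blockTriangular hbt
  refine le_antisymm (minorIdeal_mul_le b D k L (low b hb)) ?_
  have h := minorIdeal_mul_le b⁻¹ (b * D) k L (low b⁻¹ fun x y h => hinv h)
  rwa [← mul_assoc, Matrix.inv_mul_of_invertible, one_mul] at h

end MinorIdeal

/-! ### Rank matrices and the essential set -/

section RankMatrix

variable {n : ℕ}

/-- The column of the `1` of `P(w)` in a given row. -/
def pos (w : Equiv.Perm (Fin n)) : Equiv.Perm (Fin n) := w.trans Fin.revPerm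

theorem pos_mul (w σ : Equiv.Perm (Fin n)) (k : Fin n) : pos (w * σ) k = pos w (σ k) := rfl

theorem permMat_eq_one_iff (w : Equiv.Perm (Fin n)) (k l : Fin n) :
    permMat w k l = 1 ↔ pos w k = l := by
  simp [permMat, pos]

theorem rankMat_eq_card (w : Equiv.Perm (Fin n)) (i j : Fin n) :
    rankMat w i j = ((Finset.Iic i).filter fun k => j ≤ pos w k).card := by
  rw [rankMat, Finset.card_filter]
  refine Finset.sum_congr rfl fun k _ => ?_
  have h : ∀ l, permMat w k l = if pos w k = l then 1 else 0 := fun l => rfl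
  simp_rw [h]
  rw [Finset.sum_ite_eq]
  simp

/-- The number of `1`s of `P(w)` strictly South-West of `(i, j)`. -/
def southWest (w : Equiv.Perm (Fin n)) (i j : Fin n) : Finset (Fin n) :=
  (Finset.Ioi i).filter fun k => pos w k < j

/-- The `1`s in rows up to `i` are North-East or North-West, those in columns before `j` are
North-West or South-West; eliminate the North-West count. -/
theorem rankMat_add (w : Equiv.Perm (Fin n)) (i j : Fin n) :
    rankMat w i j + j = i + 1 + (southWest w i j).card := by
  have h1 : ((Finset.Iic i).filter fun k => j ≤ pos w k).card +
      ((Finset.Iic i).filter fun k => ¬ j ≤ pos w k).card = i + 1 := by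
    rw [Finset.card_filter_add_card_filter_not, Fin.card_Iic]
  have h2 : ((Finset.Iic i).filter fun k => ¬ j ≤ pos w k).card + (southWest w i j).card = j := by
    rw [southWest, ← Finset.card_union_of_disjoint, ← Fin.card_Iio j,
      ← Finset.card_map (pos w).symm.toEmbedding (s := Finset.Iio j)]
    · congr 1
      ext k
      have := le_or_gt k i
      simp only [Finset.mem_union, Finset.mem_filter, Finset.mem_Iic, Finset.mem_Ioi, not_le,
        Finset.mem_map_equiv, Equiv.symm_symm, Finset.mem_Iio]
      tauto
    · rw [Finset.disjoint_left]
      intro k hk hk'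
      simp only [Finset.mem_filter, Finset.mem_Iic, Finset.mem_Ioi] at hk hk'
      exact absurd hk.1 (not_le.2 hk'.1)
  rw [rankMat_eq_card]
  omega

theorem rankMat_le_row (w : Equiv.Perm (Fin n)) (i j : Fin n) : rankMat w i j ≤ i + 1 := by
  rw [rankMat_eq_card, ← Fin.card_Iic]
  exact Finset.card_filter_le _ _

theorem rankMat_le_col (w : Equiv.Perm (Fin n)) (i j : Fin n) : rankMat w i j ≤ n - j := by
  rw [rankMat_eq_card, ← Fin.card_Ici]
  exact Finset.card_le_card_of_injOn (pos w) (fun k hk => by simp_all) (pos w).injective.injOn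

theorem mem_diagram_iff (w : Equiv.Perm (Fin n)) (i j : Fin n) :
    (i, j) ∈ diagram w ↔ (∀ k ≤ i, pos w k ≠ j) ∧ pos w i < j := by
  simp only [diagram, Set.mem_ofPred_eq, ne_eq, permMat_eq_one_iff]
  refine and_congr_right fun _ => ⟨fun h => ?_, fun h l hl hl' => ?_⟩
  · by_contra! h'
    exact h _ h' rfl
  · exact absurd (hl' ▸ h) (not_lt.2 hl)

theorem definedByInclusions_iff (w : Equiv.Perm (Fin n)) :
    DefinedByInclusions w ↔
      ∀ i j, (i, j) ∈ essentialSet w → rankMat w i j = 0 ∨ southWest w i j = ∅ := by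
  simp only [DefinedByInclusions, Prod.forall, ne_eq, permMat_eq_one_iff]
  refine forall_congr' fun i => forall_congr' fun j => imp_congr_right fun _ => or_congr ?_ ?_
  · rw [rankMat_eq_card, Finset.card_eq_zero, Finset.filter_eq_empty_iff]
    refine ⟨fun h k hk hk' => h k (by simpa using hk) _ hk' rfl, fun h k hk l hl hl' => ?_⟩
    exact h (by simpa using hk) (hl'.symm ▸ hl)
  · rw [southWest, Finset.filter_eq_empty_iff]
    refine ⟨fun h k hk hk' => h k (by simpa using hk) _ hk' rfl, fun h k hk l hl hl' => ?_⟩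
    exact h (by simpa using hk) (hl'.symm ▸ hl)

/-- Swapping two `1`s in North-East/South-West position lowers the rank matrix. -/
theorem rankMat_mul_swap_le (w : Equiv.Perm (Fin n)) {x y : Fin n} (hxy : x ≤ y)
    (hu : pos w y ≤ pos w x) (i j : Fin n) :
    rankMat (w * Equiv.swap x y) i j ≤ rankMat w i j := by
  rw [rankMat_eq_card, rankMat_eq_card]
  by_cases hy : y ≤ i
  · refine Finset.card_le_card_of_injOn (Equiv.swap x y) (fun k hk => ?_)
      (Equiv.injective _).injOn
    simp only [Finset.mem_coe, Finset.mem_filter, Finset.mem_Iic] at hk ⊢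
    rw [pos_mul] at hk
    refine ⟨?_, hk.2⟩
    rw [Equiv.swap_apply_def]
    split_ifs
    exacts [hy, hxy.trans hy, hk.1]
  · refine Finset.card_le_card fun k hk => ?_
    simp only [Finset.mem_filter, Finset.mem_Iic] at hk ⊢
    rw [pos_mul] at hk
    refine ⟨hk.1, ?_⟩
    have hky : k ≠ y := fun h => hy (h ▸ hk.1)
    by_cases hkx : k = x
    · subst hkx
      rw [Equiv.swap_apply_left] at hk
      exact hk.2.trans hu
    · exact Equiv.swap_apply_of_ne_of_ne hkx hky ▸ hk.2

theorem rankMat_mul_swap_eq (w : Equiv.Perm (Fin n)) {x y i j : Fin n}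
    (h : (x ≤ i ↔ y ≤ i) ∨ (j ≤ pos w x ↔ j ≤ pos w y)) :
    rankMat (w * Equiv.swap x y) i j = rankMat w i j := by
  rw [rankMat_eq_card, rankMat_eq_card]
  rcases h with h | h
  · refine Finset.card_equiv (Equiv.swap x y) fun k => ?_
    simp only [Finset.mem_filter, Finset.mem_Iic]
    rw [pos_mul]
    rw [Equiv.swap_apply_def]
    split_ifs with h1 h2 <;> simp_all
  · congr 1
    refine Finset.filter_congr fun k _ => ?_
    rw [pos_mul, Equiv.swap_apply_def]
    split_ifs with h1 h2 <;> simp_all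

theorem exists_of_mem_essentialSet (w : Equiv.Perm (Fin n)) {i j : Fin n}
    (h : (i, j) ∈ essentialSet w) :
    ∃ i' j' : Fin n, (i' : ℕ) = i + 1 ∧ (j' : ℕ) + 1 = j ∧ pos w i < j ∧ j ≤ pos w i' ∧
      (∃ k, i < k ∧ pos w k = j) ∧ ∃ a ≤ i, pos w a = j' := by
  obtain ⟨hd, hS, hW⟩ := h
  obtain ⟨h1, h2⟩ := (mem_diagram_iff w i j).1 hd
  obtain ⟨k, hk⟩ := (pos w).surjective j
  have hik : i < k := lt_of_not_ge fun h => h1 k h hk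
  have hi : (i : ℕ) + 1 < n := by have := k.2; omega
  have hj : (j : ℕ) - 1 < n := by omega
  refine ⟨⟨i + 1, hi⟩, ⟨j - 1, hj⟩, rfl, by change (j : ℕ) - 1 + 1 = j; omega, h2, ?_, ⟨k, hik, hk⟩,
    ?_⟩
  · by_contra! hlt
    refine hS ⟨i + 1, hi⟩ rfl ((mem_diagram_iff _ _ _).2 ⟨fun k' hk' => ?_, hlt⟩)
    rcases eq_or_lt_of_le hk' with rfl | hk'
    · exact hlt.ne
    · exact h1 k' (by simp only [Fin.lt_def, Fin.le_def] at *; omega)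
  · by_contra! hne
    refine hW ⟨j - 1, hj⟩ (by change (j : ℕ) - 1 + 1 = j; omega)
      ((mem_diagram_iff _ _ _).2 ⟨hne, ?_⟩)
    have := hne i le_rfl
    simp only [Fin.lt_def, ne_eq, Fin.ext_iff] at *
    omega

/-- At an essential box the rank can be raised by one, without raising it at any other box. -/
theorem exists_rankMat_succ (w : Equiv.Perm (Fin n)) {i j : Fin n}
    (h : (i, j) ∈ essentialSet w) :
    ∃ w' : Equiv.Perm (Fin n), rankMat w' i j = rankMat w i j + 1 ∧
      ∀ i' j', (i', j') ≠ (i, j) → rankMat w' i' j' ≤ rankMat w i' j' := by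
  obtain ⟨s, m, hs, hm, hui, hus, ⟨k, hik, huk⟩, a, hai, hua⟩ := exists_of_mem_essentialSet w h
  have hsk : s ≤ k := by simp only [Fin.lt_def, Fin.le_def] at *; omega
  have his : i < s := by simp only [Fin.lt_def, Fin.le_def] at *; omega
  have hmj : m < j := by simp only [Fin.lt_def, Fin.le_def] at *; omega
  have hasn : s ≠ a := (hai.trans_lt his).ne'
  have hkan : k ≠ a := (hai.trans_lt hik).ne'
  -- Two rank-lowering swaps, neither affecting the rank at `(i, j)`, bring `1`s to `(i, j - 1)` and
  -- `(i + 1, j)`. This one moves the `1` of column `j - 1` down to row `i`.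
  set w1 := w * Equiv.swap a i with hw1
  have h1s : pos w1 s = pos w s := by
    rw [hw1, pos_mul, Equiv.swap_apply_of_ne_of_ne hasn his.ne']
  have h1k : pos w1 k = j := by
    rw [hw1, pos_mul, Equiv.swap_apply_of_ne_of_ne hkan hik.ne', huk]
  have h1i : pos w1 i = m := by rw [hw1, pos_mul, Equiv.swap_apply_right, hua]
  -- This one moves the `1` of column `j` up to row `i + 1`.
  set w2 := w1 * Equiv.swap s k with hw2
  have h2s : pos w2 s = j := by rw [hw2, pos_mul, Equiv.swap_apply_left, h1k]
  have h2i : pos w2 i = m := by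
    rw [hw2, pos_mul, Equiv.swap_apply_of_ne_of_ne his.ne hik.ne, h1i]
  have hle : ∀ i' j', rankMat w2 i' j' ≤ rankMat w i' j' := fun i' j' =>
    (rankMat_mul_swap_le w1 hsk (by rw [h1s, h1k]; exact hus) i' j').trans
      (rankMat_mul_swap_le w hai (by
        rw [hua]; simp only [Fin.lt_def, Fin.le_def] at *; omega) i' j')
  have heq : rankMat w2 i j = rankMat w i j := by
    rw [hw2, rankMat_mul_swap_eq w1 (Or.inl (iff_of_false (not_le.2 his) (not_le.2 hik))), hw1,
      rankMat_mul_swap_eq w (Or.inl (iff_of_true hai le_rfl))]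
  refine ⟨w2 * Equiv.swap i s, ?_, fun i' j' hne => (Eq.le ?_).trans (hle i' j')⟩
  · rw [← heq, rankMat_eq_card, rankMat_eq_card, ← Finset.card_insert_of_notMem (a := i)]
    · congr 1
      ext x
      simp only [Finset.mem_filter, Finset.mem_Iic, Finset.mem_insert]
      rw [pos_mul]
      by_cases hx : x = i
      · simp [hx, h2s]
      · by_cases hxi : x ≤ i
        · rw [Equiv.swap_apply_of_ne_of_ne hx (hxi.trans_lt his).ne]
          simp [hx]
        · simp [hx, hxi]
    · simp [h2i, hmj]
  -- The last swap exchanges `1`s in adjacent rows and adjacent columns, so only the box `(i, j)`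
  -- sees it.
  · refine rankMat_mul_swap_eq w2 ?_
    rw [h2i, h2s]
    simp only [ne_eq, Prod.mk.injEq, Fin.ext_iff, Fin.lt_def, Fin.le_def] at *
    omega

end RankMatrix

/-! ### Evaluation at symmetric matrices -/

section Evaluation

variable {K : Type*} [Field K] {n : ℕ} {R : Type*} [CommRing R] [Algebra K R]

/-- Evaluation of polynomials on symmetric matrices at a given symmetric matrix. -/
noncomputable def evalSym (M : Matrix (Fin n) (Fin n) R) (hM : M.IsSymm) :
    SymRing K n →ₐ[K] R :=
  MvPolynomial.aeval (Sym2.lift ⟨fun x y => M x y, fun x y => (hM.apply x y).symm⟩)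

theorem genericSym_map_evalSym {M : Matrix (Fin n) (Fin n) R} (hM : M.IsSymm) :
    (genericSym K n).map (evalSym (K := K) M hM).toRingHom = M := by
  ext x y
  simp [genericSym, evalSym]

theorem minorIdeal_le_ker_evalSym {M : Matrix (Fin n) (Fin n) R} (hM : M.IsSymm) (k : ℕ)
    (I L : Finset (Fin n)) :
    minorIdeal (genericSym K n) k I L ≤ RingHom.ker (evalSym (K := K) M hM).toRingHom ↔
      minorIdeal M k I L = ⊥ := by
  rw [← Ideal.map_eq_bot_iff_le_ker, map_minorIdeal, genericSym_map_evalSym]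

theorem Jsym_le_ker_evalSym {M : Matrix (Fin n) (Fin n) R} (hM : M.IsSymm)
    (w : Equiv.Perm (Fin n)) :
    Jsym K w ≤ RingHom.ker (evalSym (K := K) M hM).toRingHom ↔
      ∀ i j, minorIdeal M (rankMat w i j + 1) (Finset.Iic i) (Finset.Ici j) = ⊥ := by
  simp only [Jsym, iSup_le_iff, minorIdeal_le_ker_evalSym]

end Evaluation

/-! ### A symmetric matrix with prescribed North-East ranks -/

section GenericPoint

variable (K : Type*) [Field K] {n : ℕ} (w : Equiv.Perm (Fin n))

/-- The monic polynomial of degree `y` vanishing at `X ^ k` for all rows `k` in which the `1` of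
`P(w)` is West of column `y`. -/
noncomputable def rowPoly (y : Fin n) : Polynomial (Polynomial K) :=
  ∏ k ∈ Finset.univ.filter (fun k => pos w k < y),
    (Polynomial.X - Polynomial.C (Polynomial.X ^ (k : ℕ)))

theorem rowPoly_monic (y : Fin n) : (rowPoly K w y).Monic :=
  Polynomial.monic_prod_of_monic _ _ fun _ _ => Polynomial.monic_X_sub_C _

theorem natDegree_rowPoly (y : Fin n) : (rowPoly K w y).natDegree = y := by
  rw [rowPoly, Polynomial.natDegree_prod_of_monic _ _ fun _ _ => Polynomial.monic_X_sub_C _]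
  simp only [Polynomial.natDegree_X_sub_C, Finset.sum_const, smul_eq_mul, mul_one]
  rw [← Fin.card_Iio y, ← Finset.card_map (pos w).symm.toEmbedding (s := Finset.Iio y)]
  congr 1
  ext k
  simp [Finset.mem_map_equiv]

theorem eval_rowPoly_eq_zero_iff (k y : Fin n) :
    (rowPoly K w y).eval (Polynomial.X ^ (k : ℕ)) = 0 ↔ pos w k < y := by
  rw [rowPoly, Polynomial.eval_prod, Finset.prod_eq_zero_iff]
  constructor
  · rintro ⟨l, hl, h⟩
    simp only [Polynomial.eval_sub, Polynomial.eval_X, Polynomial.eval_C, sub_eq_zero] at h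
    have := congrArg Polynomial.natDegree h
    simp only [Polynomial.natDegree_X_pow] at this
    rw [Fin.ext this]
    simpa using hl
  · intro h
    exact ⟨k, by simpa using h, by simp⟩

/-- Coefficients of the polynomials `rowPoly`. -/
noncomputable def coeffMat : Matrix (Fin n) (Fin n) (Polynomial K) :=
  Matrix.of fun x k => (rowPoly K w x).coeff k

/-- Values of the polynomials `rowPoly` at powers of the variable. -/
noncomputable def valueMat : Matrix (Fin n) (Fin n) (Polynomial K) :=
  Matrix.of fun k y => (rowPoly K w y).eval (Polynomial.X ^ (k : ℕ))

/-- A symmetric matrix whose North-East submatrices have the ranks prescribed by `w`. -/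
noncomputable def genericPoint : Matrix (Fin n) (Fin n) (Polynomial K) :=
  coeffMat K w * valueMat K w

/-- Evaluating polynomials at `X ^ k` multiplies their coefficients by the matrix `V` with entries
`X ^ (k * l)`. Hence the matrix is `c * V * cᵀ` with `c = coeffMat K w` and `V` symmetric. -/
theorem genericPoint_isSymm : (genericPoint K w).IsSymm := by
  have h : valueMat K w =
      (Matrix.of fun k l : Fin n => (Polynomial.X : Polynomial K) ^ ((k : ℕ) * l)) *
        (coeffMat K w).transpose := by
    ext1 k y
    rw [valueMat, Matrix.of_apply, Matrix.mul_apply,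
      Polynomial.eval_eq_sum_range' ((natDegree_rowPoly K w y).trans_lt y.2), Finset.sum_range]
    refine Finset.sum_congr rfl fun l _ => ?_
    simp only [Matrix.of_apply, Matrix.transpose_apply, coeffMat]
    rw [← pow_mul, mul_comm]
  rw [genericPoint, h, Matrix.IsSymm, Matrix.transpose_mul, Matrix.transpose_mul,
    Matrix.transpose_transpose, mul_assoc]
  congr 2
  ext1 k l
  simp [mul_comm]

theorem minorIdeal_genericPoint (k : ℕ) (i : Fin n) (L : Finset (Fin n)) :
    minorIdeal (genericPoint K w) k (Finset.Iic i) L =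
      minorIdeal (valueMat K w) k (Finset.Iic i) L := by
  refine minorIdeal_unitriangular_mul (fun x y hxy => ?_) (fun x => ?_) _ k i L
  · exact Polynomial.coeff_eq_zero_of_natDegree_lt (p := rowPoly K w x)
      ((natDegree_rowPoly K w x).trans_lt hxy)
  · have := (rowPoly_monic K w x).coeff_natDegree
    rwa [natDegree_rowPoly] at this

/-- The unitriangular factor can be dropped. In `valueMat` the entry at `(k, y)` vanishes exactly
when the `1` of row `k` is West of column `y`, so only `rankMat w i j` rows of the North-East block
are nonzero, and they contain a triangular minor with nonzero diagonal. -/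
theorem minorIdeal_genericPoint_eq_bot_iff (k : ℕ) (i j : Fin n) :
    minorIdeal (genericPoint K w) k (Finset.Iic i) (Finset.Ici j) = ⊥ ↔ rankMat w i j < k := by
  rw [minorIdeal_genericPoint]
  constructor
  · intro h
    by_contra! hk
    have h' : minorIdeal (valueMat K w) (rankMat w i j) (Finset.Iic i) (Finset.Ici j) = ⊥ :=
      eq_bot_mono (minorIdeal_antitone _ _ _ hk) h
    -- The columns of the `1`s North-East of `(i, j)`; pairing each with the row of its `1` makes
    -- the minor triangular.
    let S := (Finset.Ici j).filter fun l => (pos w).symm l ≤ i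
    have hS : S.card = rankMat w i j := by
      rw [rankMat_eq_card, ← Finset.card_map (pos w).symm.toEmbedding]
      congr 1
      ext x
      simp [S, Finset.mem_map_equiv, and_comm]
    have hmem := det_submatrix_mem_minorIdeal (ι := S) (valueMat K w) (k := rankMat w i j)
      (I := Finset.Iic i) (L := Finset.Ici j) (by rw [Fintype.card_coe, hS])
      (f := fun l => (pos w).symm l) (g := fun l => l)
      (fun l => by simpa using (Finset.mem_filter.1 l.2).2)
      (fun l => (Finset.mem_filter.1 l.2).1)
    rw [h', Ideal.mem_bot, Matrix.det_of_isLowerTriangular, Finset.prod_eq_zero_iff] at hmem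
    · obtain ⟨l, -, hl⟩ := hmem
      have := (eval_rowPoly_eq_zero_iff K w _ _).1 hl
      simp at this
    · intro l l' hl
      refine (eval_rowPoly_eq_zero_iff K w _ _).2 ?_
      rw [Equiv.apply_symm_apply]
      exact hl
  · intro h
    rw [minorIdeal_eq_bot_iff]
    intro f g hf hg
    obtain ⟨t, ht⟩ : ∃ t, pos w (f t) < j := by
      by_contra! hall
      rw [rankMat_eq_card] at h
      have := Finset.card_le_card_of_injOn f (s := Finset.univ)
        (t := (Finset.Iic i).filter fun k => j ≤ pos w k)
        (fun t _ => Finset.mem_coe.2 (Finset.mem_filter.2 ⟨hf t, hall t⟩)) f.injective.injOn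
      simp only [Finset.card_univ, Fintype.card_fin] at this
      omega
    refine Matrix.det_eq_zero_of_row_eq_zero t fun s => ?_
    exact (eval_rowPoly_eq_zero_iff K w _ _).2 (ht.trans_le (Finset.mem_Ici.1 (hg s)))

theorem Jsym_le_ker_genericPoint_iff (v : Equiv.Perm (Fin n)) :
    Jsym K v ≤ RingHom.ker (evalSym (K := K) (genericPoint K w) (genericPoint_isSymm K w)).toRingHom ↔
      ∀ i j, rankMat w i j ≤ rankMat v i j := by
  simp only [Jsym_le_ker_evalSym, minorIdeal_genericPoint_eq_bot_iff, Nat.lt_succ_iff]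

theorem rankMat_le_of_Jsym_le {v : Equiv.Perm (Fin n)} (h : Jsym K v ≤ Jsym K w) (i j : Fin n) :
    rankMat w i j ≤ rankMat v i j :=
  (Jsym_le_ker_genericPoint_iff K w v).1
    (h.trans ((Jsym_le_ker_genericPoint_iff K w w).2 fun _ _ => le_rfl)) i j

end GenericPoint

/-! ### Reduction to the essential set -/

section EssentialBoxes

variable (K : Type*) [Field K] {n : ℕ} (w : Equiv.Perm (Fin n))

/-- The contribution of the box `(i, j)` to `J_sym(w)`. -/
noncomputable def boxIdeal (i j : Fin n) : Ideal (SymRing K n) :=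
  minorIdeal (genericSym K n) (rankMat w i j + 1) (Finset.Iic i) (Finset.Ici j)

theorem boxIdeal_le_Jsym (i j : Fin n) : boxIdeal K w i j ≤ Jsym K w :=
  le_iSup₂_of_le i j le_rfl

/-- A step South or West inside the diagram keeps the rank and enlarges the submatrix; such steps
end at an essential box. -/
theorem boxIdeal_le_of_mem_diagram {I : Ideal (SymRing K n)}
    (hI : ∀ i j, (i, j) ∈ essentialSet w → boxIdeal K w i j ≤ I) {i j : Fin n}
    (h : (i, j) ∈ diagram w) : boxIdeal K w i j ≤ I := by
  induction hm : n - (i : ℕ) + j using Nat.strong_induction_on generalizing i j with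
  | _ m ih =>
  by_cases he : (i, j) ∈ essentialSet w
  · exact hI i j he
  have hr := (mem_diagram_iff w i j).1 h
  have : (∃ i' : Fin n, (i' : ℕ) = i + 1 ∧ (i', j) ∈ diagram w) ∨
      ∃ j' : Fin n, (j' : ℕ) + 1 = j ∧ (i, j') ∈ diagram w := by
    by_contra! hne
    exact he ⟨h, hne.1, hne.2⟩
  rcases this with ⟨i', hi', h'⟩ | ⟨j', hj', h'⟩
  · have hr' := (mem_diagram_iff w i' j).1 h'
    have hle : i ≤ i' := by simp only [Fin.le_def]; omega
    refine le_trans ?_ (ih _ (by omega) h' rfl)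
    have heq : rankMat w i' j = rankMat w i j := by
      rw [rankMat_eq_card, rankMat_eq_card]
      congr 1
      ext k
      simp only [Finset.mem_filter, Finset.mem_Iic, and_congr_left_iff]
      intro hk
      refine ⟨fun hki => ?_, fun hki => hki.trans hle⟩
      have : k ≠ i' := by rintro rfl; exact absurd hk (not_le.2 hr'.2)
      simp only [Fin.le_def, ne_eq, Fin.ext_iff] at *
      omega
    rw [boxIdeal, boxIdeal, heq]
    exact minorIdeal_mono _ _ (Finset.Iic_subset_Iic.2 hle) subset_rfl
  · have hr' := (mem_diagram_iff w i j').1 h'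
    have hle : j' ≤ j := by simp only [Fin.le_def]; omega
    refine le_trans ?_ (ih _ (by omega) h' rfl)
    have heq : rankMat w i j' = rankMat w i j := by
      rw [rankMat_eq_card, rankMat_eq_card]
      congr 1
      ext k
      simp only [Finset.mem_filter, Finset.mem_Iic, and_congr_right_iff]
      intro hk
      refine ⟨fun hkj => ?_, fun hkj => hle.trans hkj⟩
      have := hr'.1 k hk
      simp only [Fin.le_def, ne_eq, Fin.ext_iff] at *
      omega
    rw [boxIdeal, boxIdeal, heq]
    exact minorIdeal_mono _ _ subset_rfl (Finset.Ici_subset_Ici.2 hle)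

/-- Outside the diagram, a `1` in row `i` or in column `j` counts towards the rank. Deleting that
row or column lowers the rank by one, and Laplace expansion bounds the ideal by that of the
neighbouring box. -/
theorem boxIdeal_le_of_essentialSet {I : Ideal (SymRing K n)}
    (hI : ∀ i j, (i, j) ∈ essentialSet w → boxIdeal K w i j ≤ I) (i j : Fin n) :
    boxIdeal K w i j ≤ I := by
  induction hm : (i : ℕ) + (n - j) using Nat.strong_induction_on generalizing i j with
  | _ m ih =>
  by_cases hd : (i, j) ∈ diagram w
  · exact boxIdeal_le_of_mem_diagram K w hI hd
  by_cases hij : j ≤ pos w i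
  · refine (minorIdeal_succ_le_erase_left _ _ _ _ i).trans ?_
    rw [rankMat_eq_card]
    by_cases hi : ∃ i' : Fin n, (i' : ℕ) + 1 = i
    · obtain ⟨i', hi'⟩ := hi
      refine le_trans (Eq.le ?_) (ih _ (by omega) i' j rfl)
      have he : (Finset.Iic i).erase i = Finset.Iic i' := by
        ext k
        simp only [Finset.mem_erase, Finset.mem_Iic, Fin.le_def, ne_eq, Fin.ext_iff]
        omega
      rw [boxIdeal, he, rankMat_eq_card, ← he, Finset.filter_erase,
        Finset.card_erase_add_one (by simp [hij])]
    -- In the top row nothing is left after the erasure, while the minors still have positive size.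
    · rw [minorIdeal_eq_bot_of_card_lt]
      · exact bot_le
      · have h0 : (i : ℕ) = 0 := by
          by_contra h0
          exact hi ⟨⟨i - 1, by omega⟩, by change (i : ℕ) - 1 + 1 = i; omega⟩
        have : 0 < ((Finset.Iic i).filter fun k => j ≤ pos w k).card :=
          Finset.card_pos.2 ⟨i, by simp [hij]⟩
        rw [Finset.card_erase_of_mem (by simp), Fin.card_Iic]
        omega
  · obtain ⟨k, hki, hkj⟩ : ∃ k ≤ i, pos w k = j := by
      by_contra! hne
      exact hd ((mem_diagram_iff w i j).2 ⟨hne, not_le.1 hij⟩)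
    refine (minorIdeal_succ_le_erase_right _ _ _ _ j).trans ?_
    rw [rankMat_eq_card]
    by_cases hj : ∃ j' : Fin n, (j' : ℕ) = j + 1
    · obtain ⟨j', hj'⟩ := hj
      refine le_trans (Eq.le ?_) (ih _ (by omega) i j' rfl)
      have he : (Finset.Ici j).erase j = Finset.Ici j' := by
        ext k
        simp only [Finset.mem_erase, Finset.mem_Ici, Fin.le_def, ne_eq, Fin.ext_iff]
        omega
      have he' : (Finset.Iic i).filter (fun k => j' ≤ pos w k) =
          ((Finset.Iic i).filter fun k => j ≤ pos w k).erase k := by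
        ext l
        have : l = k ↔ pos w l = j := by rw [← hkj, (pos w).apply_eq_iff_eq]
        simp only [Finset.mem_erase, Finset.mem_filter, Finset.mem_Iic, ne_eq, this, Fin.le_def,
          Fin.ext_iff]
        omega
      rw [boxIdeal, he, rankMat_eq_card, he', Finset.card_erase_add_one (by simp [hki, hkj])]
    · rw [← minorIdeal_transpose, minorIdeal_eq_bot_of_card_lt]
      · exact bot_le
      · have h0 : (j : ℕ) + 1 = n := by
          by_contra h0
          exact hj ⟨⟨j + 1, by omega⟩, rfl⟩
        have : 0 < ((Finset.Iic i).filter fun k => j ≤ pos w k).card :=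
          Finset.card_pos.2 ⟨k, by simp [hki, hkj]⟩
        rw [Finset.card_erase_of_mem (by simp), Fin.card_Ici]
        omega

theorem Jsym_le_of_essentialSet {I : Ideal (SymRing K n)}
    (hI : ∀ i j, (i, j) ∈ essentialSet w → boxIdeal K w i j ≤ I) : Jsym K w ≤ I :=
  iSup₂_le fun i j => boxIdeal_le_of_essentialSet K w hI i j

end EssentialBoxes

/-! ### Box ideals as Schubert CI ideals -/

section Bigrassmannian

variable {n : ℕ}

/-- The permutation whose diagram is the rectangle with South-West corner `(i, j)` and North-East
corner `(r, n - 1 - r)`. -/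
theorem exists_bigrassmannian (i j : Fin n) {r : ℕ} (hi : r ≤ i + 1) (hj : r ≤ n - j)
    (hij : (i : ℕ) + 1 ≤ r + j) :
    ∃ v : Equiv.Perm (Fin n), ∀ k : Fin n, (pos v k : ℕ) =
      if (k : ℕ) < r then n - 1 - k else if (k : ℕ) ≤ i then j - 1 - (k - r)
      else if (k : ℕ) ≤ i + n - j - r then n - 1 - r - (k - i - 1) else n - 1 - k := by
  let f : Fin n → Fin n := fun k =>
    ⟨if (k : ℕ) < r then n - 1 - k else if (k : ℕ) ≤ i then j - 1 - (k - r)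
      else if (k : ℕ) ≤ i + n - j - r then n - 1 - r - (k - i - 1) else n - 1 - k, by
      split_ifs <;> omega⟩
  have hf : Function.Injective f := by
    intro k l hkl
    simp only [f, Fin.mk.injEq] at hkl
    ext
    split_ifs at hkl <;> omega
  refine ⟨(Equiv.ofBijective f (Finite.injective_iff_bijective.1 hf)).trans Fin.revPerm,
    fun k => ?_⟩
  simp [pos, f]

/-- The diagram of the bigrassmannian permutation is a rectangle, so `(i, j)` is the only box that
can be essential, and the rank there is `r`. -/
theorem exists_Jsym_eq_minorIdeal (K : Type*) [Field K] (i j : Fin n) {r : ℕ} (hi : r ≤ i + 1)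
    (hj : r ≤ n - j) (hij : (i : ℕ) + 1 ≤ r + j) :
    ∃ v : Equiv.Perm (Fin n),
      Jsym K v = minorIdeal (genericSym K n) (r + 1) (Finset.Iic i) (Finset.Ici j) := by
  obtain ⟨v, hv⟩ := exists_bigrassmannian i j hi hj hij
  have hr : rankMat v i j = r := by
    have hset : (Finset.Iic i).filter (fun k => j ≤ pos v k) =
        Finset.univ.filter fun k : Fin n => (k : ℕ) < r := by
      ext k
      simp only [Finset.mem_filter, Finset.mem_Iic, Finset.mem_univ, true_and, Fin.le_def, hv k]
      split_ifs <;> omega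
    rw [rankMat_eq_card, hset, Fin.card_filter_val_lt]
    omega
  have hdiag : ∀ k l : Fin n, (k, l) ∈ diagram v ↔
      r ≤ (k : ℕ) ∧ k ≤ i ∧ j ≤ l ∧ (l : ℕ) + r < n := by
    intro k l
    rw [mem_diagram_iff, Fin.lt_def]
    simp only [Fin.le_def, ne_eq, Fin.ext_iff]
    constructor
    · rintro ⟨h1, h2⟩
      by_contra hout
      obtain ⟨x, hxk, hx⟩ : ∃ x : ℕ, x ≤ k ∧ (x < r ∧ n - 1 - x = l ∨
          r ≤ x ∧ x ≤ i ∧ j - 1 - (x - r) = l ∨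
          i < x ∧ x ≤ i + n - j - r ∧ n - 1 - r - (x - i - 1) = l ∨
          i + n - j - r < x ∧ n - 1 - x = l) := by
        rw [hv] at h2
        by_cases c1 : n ≤ l + r
        · exact ⟨n - 1 - l, by split_ifs at h2 <;> omega, by omega⟩
        by_cases c2 : (j : ℕ) ≤ l
        · exact ⟨n - r - l + i, by split_ifs at h2 <;> omega, by omega⟩
        by_cases c3 : (j : ℕ) + r ≤ l + 1 + i
        · exact ⟨j - 1 - l + r, by split_ifs at h2 <;> omega, by omega⟩
        · exact ⟨n - 1 - l, by split_ifs at h2 <;> omega, by omega⟩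
      refine h1 ⟨x, hxk.trans_lt k.2⟩ hxk ?_
      rw [hv]
      dsimp only
      split_ifs <;> omega
    · rintro ⟨h1, h2, h3, h4⟩
      refine ⟨fun x hx => ?_, ?_⟩ <;> rw [hv] <;> split_ifs <;> omega
  refine ⟨v, le_antisymm (Jsym_le_of_essentialSet K v fun k l hkl => ?_) ?_⟩
  · obtain ⟨hd, hS, hW⟩ := hkl
    rw [hdiag] at hd
    have hki : k = i := by
      by_contra hne
      rw [← ne_eq, Ne, Fin.ext_iff] at hne
      have := hd.2.1
      rw [Fin.le_def] at this
      refine hS ⟨k + 1, by omega⟩ rfl ((hdiag _ _).2 ⟨?_, ?_, hd.2.2⟩)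
      · exact hd.1.trans (Nat.le_succ _)
      · rw [Fin.le_def]; change (k : ℕ) + 1 ≤ i; omega
    have hlj : l = j := by
      by_contra hne
      rw [Fin.ext_iff] at hne
      have := hd.2.2.1
      rw [Fin.le_def] at this
      refine hW ⟨l - 1, by omega⟩ (by change (l : ℕ) - 1 + 1 = l; omega)
        ((hdiag _ _).2 ⟨hd.1, hd.2.1, ?_, ?_⟩)
      · rw [Fin.le_def]; change (j : ℕ) ≤ l - 1; omega
      · change (l : ℕ) - 1 + r < n; omega
    rw [hki, hlj, boxIdeal, hr]
  · have := boxIdeal_le_Jsym K v i j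
    rwa [boxIdeal, hr] at this

/-- Boxes of a permutation at which one of the two conditions of `DefinedByInclusions` holds
contribute Schubert conditional independence ideals. -/
theorem isSchubertCI_boxIdeal (K : Type*) [Field K] (w : Equiv.Perm (Fin n)) (i j : Fin n)
    (h : rankMat w i j = 0 ∨ southWest w i j = ∅) : IsSchubertCI (boxIdeal K w i j) := by
  have hadd := rankMat_add w i j
  -- Truncated subtraction covers both alternatives, and matches the cardinality of `Finset.Icc j i`
  -- even when it is empty.
  have hr : rankMat w i j = i + 1 - j := by
    rcases h with h | h
    · omega
    · rw [h, Finset.card_empty] at hadd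
      omega
  constructor
  · obtain ⟨v, hv⟩ := exists_Jsym_eq_minorIdeal K i j (rankMat_le_row w i j) (rankMat_le_col w i j)
      (by omega)
    exact ⟨v, hv.symm⟩
  · refine ⟨Finset.Iic i \ Finset.Icc j i, Finset.Ici j \ Finset.Icc j i, Finset.Icc j i, ?_,
      Finset.sdiff_disjoint, Finset.sdiff_disjoint, ?_⟩
    · rw [Finset.disjoint_left]
      intro x
      simp only [Finset.mem_sdiff, Finset.mem_Iic, Finset.mem_Icc, Finset.mem_Ici]
      tauto
    · rw [boxIdeal, ciIdeal, Finset.sdiff_union_of_subset, Finset.sdiff_union_of_subset,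
        Fin.card_Icc, hr]
      · exact fun x hx => Finset.mem_Ici.2 (Finset.mem_Icc.1 hx).1
      · exact fun x hx => Finset.mem_Iic.2 (Finset.mem_Icc.1 hx).2

theorem isSumOfSchubertCI_of_definedByInclusions (K : Type*) [Field K] (w : Equiv.Perm (Fin n))
    (h : DefinedByInclusions w) : IsSumOfSchubertCI (Jsym K w) := by
  classical
  rw [definedByInclusions_iff] at h
  refine ⟨(Set.toFinite (essentialSet w)).toFinset.image fun p => boxIdeal K w p.1 p.2, ?_, ?_⟩
  · intro J hJ
    obtain ⟨p, hp, rfl⟩ := Finset.mem_image.1 hJ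
    exact isSchubertCI_boxIdeal K w _ _ (h _ _ (by simpa using hp))
  · rw [Ideal.sum_eq_sup]
    refine le_antisymm (Jsym_le_of_essentialSet K w fun i j hij => ?_) (Finset.sup_le fun J hJ => ?_)
    · exact Finset.le_sup (f := fun J => J)
        (Finset.mem_image.2 ⟨(i, j), by simpa using hij, rfl⟩)
    · obtain ⟨p, -, rfl⟩ := Finset.mem_image.1 hJ
      exact boxIdeal_le_Jsym K w _ _

end Bigrassmannian

/-! ### Test matrices for CI ideals -/

section SwapMatrix

variable {n : ℕ}

/-- The partial permutation matrix on the index set `D ∪ {a, b}` that swaps `a` and `b`. -/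
def swapMat (R : Type*) [Zero R] [One R] (a b : Fin n) (D : Finset (Fin n)) :
    Matrix (Fin n) (Fin n) R :=
  Matrix.of fun x y => if x ∈ insert a (insert b D) ∧ y = Equiv.swap a b x then 1 else 0

theorem swapMat_isSymm (R : Type*) [Zero R] [One R] (a b : Fin n) (D : Finset (Fin n)) :
    (swapMat R a b D).IsSymm := by
  ext x y
  simp only [swapMat, Matrix.transpose_apply, Matrix.of_apply]
  congr 1
  have hD : ∀ z, Equiv.swap a b z ∈ insert a (insert b D) ↔ z ∈ insert a (insert b D) := by
    intro z
    rw [Equiv.swap_apply_def]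
    split_ifs with h1 h2 <;> simp_all
  refine propext ⟨?_, ?_⟩ <;>
  · rintro ⟨h, rfl⟩
    exact ⟨(hD _).2 h, (Equiv.swap_apply_self a b _).symm⟩

/-- The minor with rows `C ∪ {a}` and columns `C ∪ {b}`, matched by the swap, is the determinant of
an identity matrix. -/
theorem minorIdeal_swapMat_ne_bot (K : Type*) [Field K] {a b : Fin n} {A B C : Finset (Fin n)}
    (ha : a ∈ A) (hb : b ∈ B) (haC : a ∉ C) (hbC : b ∉ C) :
    minorIdeal (swapMat K a b C) (C.card + 1) (A ∪ C) (B ∪ C) ≠ ⊥ := by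
  intro h
  have hmem := det_submatrix_mem_minorIdeal (ι := (insert a C : Finset (Fin n))) (swapMat K a b C)
    (k := C.card + 1) (I := A ∪ C) (L := B ∪ C) (f := fun x => x)
    (g := fun x => Equiv.swap a b x)
    (by rw [Fintype.card_coe, Finset.card_insert_of_notMem haC]) ?_ ?_
  · have h1 : (swapMat K a b C).submatrix (fun x : (insert a C : Finset (Fin n)) => (x : Fin n))
        (fun x : (insert a C : Finset (Fin n)) => Equiv.swap a b x) = 1 := by
      ext ⟨x, hx⟩ ⟨y, hy⟩
      have hx' : x ∈ insert a (insert b C) := by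
        simp only [Finset.mem_insert] at hx ⊢
        tauto
      simp only [swapMat, Matrix.submatrix_apply, Matrix.of_apply, hx', true_and,
        EmbeddingLike.apply_eq_iff_eq, Matrix.one_apply, Subtype.mk.injEq, eq_comm]
    rw [h1, Matrix.det_one, h, Ideal.mem_bot] at hmem
    exact one_ne_zero hmem
  · rintro ⟨x, hx⟩
    rcases Finset.mem_insert.1 hx with rfl | hx
    · exact Finset.mem_union_left _ ha
    · exact Finset.mem_union_right _ hx
  · rintro ⟨x, hx⟩
    rcases Finset.mem_insert.1 hx with rfl | hx
    · simpa using Or.inl hb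
    · have hxa : x ≠ a := fun h => haC (h ▸ hx)
      have hxb : x ≠ b := fun h => hbC (h ▸ hx)
      simpa only [Equiv.swap_apply_of_ne_of_ne hxa hxb] using Finset.mem_union_right _ hx

/-- A nonzero Leibniz term picks `k` entries equal to `1` in distinct rows of the North-East block.
-/
theorem card_of_minorIdeal_swapMat_ne_bot (K : Type*) [Field K] {a b i j : Fin n}
    {C : Finset (Fin n)} {k : ℕ} {f g : Fin k ↪o Fin n} (hf : ∀ t, f t ∈ Finset.Iic i)
    (hg : ∀ t, g t ∈ Finset.Ici j) (h : ((swapMat K a b C).submatrix f g).det ≠ 0) :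
    k ≤ ((insert a (insert b C)).filter fun x => x ≤ i ∧ j ≤ Equiv.swap a b x).card := by
  rw [Matrix.det_apply'] at h
  obtain ⟨σ, -, hσ⟩ := Finset.exists_ne_zero_of_sum_ne_zero h
  have hσ' : ∀ t, swapMat K a b C (f (σ t)) (g t) ≠ 0 := fun t =>
    Finset.prod_ne_zero_iff.1 (right_ne_zero_of_mul hσ) t (Finset.mem_univ t)
  have hle := Finset.card_le_card_of_injOn (fun t => f (σ t)) (s := Finset.univ)
    (t := (insert a (insert b C)).filter fun x => x ≤ i ∧ j ≤ Equiv.swap a b x)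
    (fun t _ => ?_) (f.injective.comp σ.injective).injOn
  · simpa using hle
  · have := hσ' t
    simp only [swapMat, Matrix.of_apply, ne_eq, ite_eq_right_iff, one_ne_zero, imp_false,
      not_not] at this
    rw [Finset.mem_coe, Finset.mem_filter]
    exact ⟨this.1, Finset.mem_Iic.1 (hf _), this.2 ▸ Finset.mem_Ici.1 (hg t)⟩

end SwapMatrix

/-! ### Sums of Schubert CI ideals force inclusions -/

section Converse

variable {n : ℕ}

/-- The bounds pinch: `r + 1 ≤ #S ≤ #(C ∩ [j, i]) + 1 ≤ #C + 1 ≤ r + 1`, and `#[j, i] ≤ r`, so every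
inclusion is an equality. -/
theorem eq_Icc_of_card_le {C S : Finset (Fin n)} {a b i j : Fin n} {r : ℕ} (haC : a ∉ C)
    (hbC : b ∉ C) (hC : C.card ≤ r) (hr : (i : ℕ) + 1 ≤ r + j) (hS : r + 1 ≤ S.card)
    (hsub : S ⊆ insert a (C ∩ Finset.Icc j i)) (hai : a ≤ i) (hjb : j ≤ b) :
    r = C.card ∧ C = Finset.Icc j i ∧ (a ≤ i ∧ a < j) ∧ j ≤ b ∧ i < b := by
  have h1 : S.card ≤ (C ∩ Finset.Icc j i).card + 1 :=
    (Finset.card_le_card hsub).trans (Finset.card_insert_le _ _)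
  have h2 : C ∩ Finset.Icc j i = C :=
    Finset.eq_of_subset_of_card_le Finset.inter_subset_left (by omega)
  rw [h2] at h1
  have h3 : C = Finset.Icc j i :=
    Finset.eq_of_subset_of_card_le (Finset.inter_eq_left.1 h2) (by rw [Fin.card_Icc]; omega)
  refine ⟨by omega, h3, ⟨hai, ?_⟩, hjb, ?_⟩
  · by_contra! h
    exact haC (h3 ▸ Finset.mem_Icc.2 ⟨h, hai⟩)
  · by_contra! h
    exact hbC (h3 ▸ Finset.mem_Icc.2 ⟨hjb, h⟩)

/-- If `J_sym(v)` is a conditional independence ideal, then the minors with one row in `A` and one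
column in `B` arise from a box at which `R(v)` has the smallest possible value. -/
theorem exists_box_of_Jsym_eq_ciIdeal {K : Type*} [Field K] {v : Equiv.Perm (Fin n)}
    {A B C : Finset (Fin n)} (hAC : Disjoint A C) (hBC : Disjoint B C)
    (h : Jsym K v = ciIdeal K A B C) {a b : Fin n} (ha : a ∈ A) (hb : b ∈ B) :
    ∃ i j, rankMat v i j = C.card ∧ C = Finset.Icc j i ∧
      ((a ≤ i ∧ a < j) ∧ j ≤ b ∧ i < b ∨ (b ≤ i ∧ b < j) ∧ j ≤ a ∧ i < a) := by
  have haC : a ∉ C := Finset.disjoint_left.1 hAC ha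
  have hbC : b ∉ C := Finset.disjoint_left.1 hBC hb
  have hN := swapMat_isSymm K a b C
  obtain ⟨i, j, hij⟩ :
      ∃ i j, minorIdeal (swapMat K a b C) (rankMat v i j + 1) (Finset.Iic i) (Finset.Ici j) ≠ ⊥ := by
    by_contra! hall
    rw [← Jsym_le_ker_evalSym (K := K) hN, h, ciIdeal, minorIdeal_le_ker_evalSym] at hall
    exact minorIdeal_swapMat_ne_bot K ha hb haC hbC hall
  rw [ne_eq, minorIdeal_eq_bot_iff] at hij
  push Not at hij
  obtain ⟨f, g, hf, hg, hfg⟩ := hij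
  have hS := card_of_minorIdeal_swapMat_ne_bot K hf hg hfg
  -- Degree comparison: on `X` times the swap matrix, everything in the CI ideal is divisible by `X
  -- ^ (C.card + 1)`, while the chosen minor is a nonzero constant times `X ^ (rankMat v i j + 1)`.
  have hC : C.card ≤ rankMat v i j := by
    let M : Matrix (Fin n) (Fin n) (Polynomial K) :=
      (Polynomial.X : Polynomial K) • (swapMat K a b C).map (Polynomial.C : K →+* Polynomial K)
    have hM : M.IsSymm := (hN.map _).smul _
    have hle : (Jsym K v).map (evalSym (K := K) M hM).toRingHom ≤
        Ideal.span {Polynomial.X ^ (C.card + 1)} := by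
      rw [h, ciIdeal, map_minorIdeal, genericSym_map_evalSym]
      exact minorIdeal_smul_le _ _ _ _ _
    have hmem : (M.submatrix f g).det ∈ Ideal.span {Polynomial.X ^ (C.card + 1)} := by
      refine hle (Ideal.map_mono (boxIdeal_le_Jsym K v i j) ?_)
      rw [boxIdeal, map_minorIdeal, genericSym_map_evalSym]
      exact Ideal.subset_span ⟨f, g, hf, hg, rfl⟩
    have hdet : (M.submatrix f g).det = Polynomial.X ^ (rankMat v i j + 1) *
        Polynomial.C ((swapMat K a b C).submatrix f g).det := by
      rw [show M.submatrix f g = (Polynomial.X : Polynomial K) •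
        ((swapMat K a b C).submatrix f g).map (Polynomial.C : K →+* Polynomial K) from rfl,
        Matrix.det_smul, Fintype.card_fin, RingHom.map_det]
      rfl
    rw [hdet, Ideal.mem_span_singleton, Polynomial.X_pow_dvd_iff] at hmem
    by_contra! hlt
    have := hmem (rankMat v i j + 1) (by omega)
    rw [Polynomial.coeff_X_pow_mul', if_pos le_rfl, Nat.sub_self, Polynomial.coeff_C_zero] at this
    exact hfg this
  have hadd := rankMat_add v i j
  set S := (insert a (insert b C)).filter fun x => x ≤ i ∧ j ≤ Equiv.swap a b x with hSdef
  have hSa : a ∈ S ↔ a ≤ i ∧ j ≤ b := by simp [hSdef]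
  have hSb : b ∈ S ↔ b ≤ i ∧ j ≤ a := by simp [hSdef]
  have hSC : ∀ x ∈ S, x = a ∨ x = b ∨ x ∈ C ∩ Finset.Icc j i := by
    intro x hx
    by_cases hxa : x = a
    · exact Or.inl hxa
    by_cases hxb : x = b
    · exact Or.inr (Or.inl hxb)
    simp only [hSdef, Finset.mem_filter, Finset.mem_insert, hxa, hxb, false_or,
      Equiv.swap_apply_of_ne_of_ne hxa hxb] at hx
    exact Or.inr (Or.inr (Finset.mem_inter.2 ⟨hx.1, Finset.mem_Icc.2 ⟨hx.2.2, hx.2.1⟩⟩))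
  -- `S` has more than `rankMat v i j` elements. With both `a` and `b` it would fit into `[j, i]`,
  -- with neither into `C`; both are too small.
  by_cases haS : a ∈ S <;> by_cases hbS : b ∈ S
  · have : S ⊆ Finset.Icc j i := by
      intro x hx
      rw [hSa] at haS
      rw [hSb] at hbS
      rcases hSC x hx with rfl | rfl | hx
      · exact Finset.mem_Icc.2 ⟨hbS.2, haS.1⟩
      · exact Finset.mem_Icc.2 ⟨haS.2, hbS.1⟩
      · exact (Finset.mem_inter.1 hx).2
    have := Finset.card_le_card this
    rw [Fin.card_Icc] at this
    omega
  · have hsub : S ⊆ insert a (C ∩ Finset.Icc j i) := by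
      intro x hx
      rcases hSC x hx with rfl | rfl | hx'
      exacts [Finset.mem_insert_self _ _, absurd hx hbS, Finset.mem_insert_of_mem hx']
    have := eq_Icc_of_card_le haC hbC hC (by omega) hS hsub (hSa.1 haS).1 (hSa.1 haS).2
    exact ⟨i, j, this.1, this.2.1, Or.inl this.2.2⟩
  · have hsub : S ⊆ insert b (C ∩ Finset.Icc j i) := by
      intro x hx
      rcases hSC x hx with rfl | rfl | hx'
      exacts [absurd hx haS, Finset.mem_insert_self _ _, Finset.mem_insert_of_mem hx']
    have := eq_Icc_of_card_le hbC haC hC (by omega) hS hsub (hSb.1 hbS).1 (hSb.1 hbS).2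
    exact ⟨i, j, this.1, this.2.1, Or.inr this.2.2⟩
  · have : S ⊆ C := by
      intro x hx
      rcases hSC x hx with rfl | rfl | hx'
      exacts [absurd hx haS, absurd hx hbS, (Finset.mem_inter.1 hx').1]
    have := Finset.card_le_card this
    omega

/-- A symmetric matrix satisfying the conditions of all boxes in
`exists_box_of_Jsym_eq_ciIdeal` satisfies the conditional independence statement. -/
theorem minorIdeal_eq_bot_of_boxes {R : Type*} [CommRing R] {M : Matrix (Fin n) (Fin n) R}
    (hM : M.IsSymm) {A B C : Finset (Fin n)}
    (h : ∀ a ∈ A, ∀ b ∈ B, ∃ i j,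
      minorIdeal M (C.card + 1) (Finset.Iic i) (Finset.Ici j) = ⊥ ∧
      C = Finset.Icc j i ∧ ((a ≤ i ∧ a < j) ∧ j ≤ b ∧ i < b ∨ (b ≤ i ∧ b < j) ∧ j ≤ a ∧ i < a)) :
    minorIdeal M (C.card + 1) (A ∪ C) (B ∪ C) = ⊥ := by
  have hsymm : ∀ k I L, minorIdeal M k I L = minorIdeal M k L I := fun k I L => by
    conv_lhs => rw [← hM.eq]
    exact minorIdeal_transpose M k I L
  rcases A.eq_empty_or_nonempty with rfl | ⟨a₀, ha₀⟩
  · exact minorIdeal_eq_bot_of_card_lt _ _ (by simp)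
  rcases B.eq_empty_or_nonempty with rfl | ⟨b₀, hb₀⟩
  · rw [hsymm]
    exact minorIdeal_eq_bot_of_card_lt _ _ (by simp)
  rcases C.eq_empty_or_nonempty with rfl | ⟨c, hc⟩
  -- For empty `C` the minors are single entries, and each is killed by its own box, after
  -- transposition if necessary.
  · simp only [Finset.card_empty, zero_add, Finset.union_empty] at h ⊢
    rw [minorIdeal_eq_bot_iff]
    intro f g hf hg
    have hmem : (M.submatrix f g).det ∈ minorIdeal M 1 {f 0} {g 0} :=
      det_submatrix_mem_minorIdeal M (Fintype.card_fin 1)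
        (fun t => Finset.mem_singleton.2 (congrArg f (Subsingleton.elim t 0)))
        (fun t => Finset.mem_singleton.2 (congrArg g (Subsingleton.elim t 0)))
    obtain ⟨i, j, hbot, hC, hcase⟩ := h (f 0) (hf 0) (g 0) (hg 0)
    rw [← Ideal.mem_bot, ← hbot]
    rcases hcase with h1 | h1
    · exact minorIdeal_mono M _ (by simpa using by omega) (by simpa using by omega) hmem
    · rw [hsymm] at hmem
      exact minorIdeal_mono M _ (by simpa using by omega) (by simpa using by omega) hmem
  -- A nonempty interval determines its endpoints, so all pairs share one box. Then `A` and `B` lie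
  -- on opposite sides of `C`, and the CI submatrix or its transpose lies inside that box's
  -- submatrix.
  · obtain ⟨i, j, hbot, hC, hcase⟩ := h a₀ ha₀ b₀ hb₀
    have hji : j ≤ i := by
      rw [hC, Finset.mem_Icc] at hc
      exact hc.1.trans hc.2
    have hall : ∀ a ∈ A, ∀ b ∈ B,
        (a ≤ i ∧ a < j) ∧ j ≤ b ∧ i < b ∨ (b ≤ i ∧ b < j) ∧ j ≤ a ∧ i < a := by
      intro a ha b hb
      obtain ⟨i', j', -, hC', hcase'⟩ := h a ha b hb
      rw [hC] at hC'
      have h1 : j ∈ Finset.Icc j' i' := hC' ▸ Finset.left_mem_Icc.2 hji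
      have h2 : i ∈ Finset.Icc j' i' := hC' ▸ Finset.right_mem_Icc.2 hji
      have hji' : j' ≤ i' := (Finset.mem_Icc.1 h1).1.trans (Finset.mem_Icc.1 h1).2
      have h3 : j' ∈ Finset.Icc j i := hC' ▸ Finset.left_mem_Icc.2 hji'
      have h4 : i' ∈ Finset.Icc j i := hC' ▸ Finset.right_mem_Icc.2 hji'
      rw [Finset.mem_Icc] at h1 h2 h3 h4
      rwa [le_antisymm h3.1 h1.1, le_antisymm h2.2 h4.2]
    have hCi : C ⊆ Finset.Iic i := hC ▸ fun x hx => Finset.mem_Iic.2 (Finset.mem_Icc.1 hx).2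
    have hCj : C ⊆ Finset.Ici j := hC ▸ fun x hx => Finset.mem_Ici.2 (Finset.mem_Icc.1 hx).1
    have key : ∀ {A B : Finset (Fin n)} {a₀ b₀}, a₀ ∈ A → b₀ ∈ B →
        (a₀ ≤ i ∧ a₀ < j) ∧ j ≤ b₀ ∧ i < b₀ →
        (∀ a ∈ A, ∀ b ∈ B,
          (a ≤ i ∧ a < j) ∧ j ≤ b ∧ i < b ∨ (b ≤ i ∧ b < j) ∧ j ≤ a ∧ i < a) →
        minorIdeal M (C.card + 1) (A ∪ C) (B ∪ C) = ⊥ := by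
      intro A B a₀ b₀ ha₀ hb₀ hcase hall
      refine eq_bot_mono (minorIdeal_mono M _ (Finset.union_subset (fun a ha => ?_) hCi)
        (Finset.union_subset (fun b hb => ?_) hCj)) hbot
      · have := hall a ha b₀ hb₀
        simp only [Finset.mem_Iic, Fin.le_def, Fin.lt_def] at *
        omega
      · have := hall a₀ ha₀ b hb
        simp only [Finset.mem_Ici, Fin.le_def, Fin.lt_def] at *
        omega
    rcases hcase with hcase | hcase
    · exact key ha₀ hb₀ hcase hall
    · rw [hsymm]
      exact key hb₀ ha₀ hcase fun b hb a ha => (hall a ha b hb).symm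

theorem definedByInclusions_of_isSumOfSchubertCI {K : Type*} [Field K] {w : Equiv.Perm (Fin n)}
    (h : IsSumOfSchubertCI (Jsym K w)) : DefinedByInclusions w := by
  rw [definedByInclusions_iff]
  intro i j hij
  by_contra! hne
  obtain ⟨hr, hsw⟩ := hne
  rw [← Finset.card_pos] at hsw
  have hadd := rankMat_add w i j
  obtain ⟨w', hw', hw'le⟩ := exists_rankMat_succ w hij
  obtain ⟨s, hs, hsum⟩ := h
  rw [Ideal.sum_eq_sup] at hsum
  have hnot : ¬ Jsym K w ≤ _ := mt (Jsym_le_ker_genericPoint_iff K w' w).1 fun h => by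
    have := h i j
    omega
  rw [hsum, Finset.sup_le_iff] at hnot
  push Not at hnot
  obtain ⟨J, hJ, hJnot⟩ := hnot
  obtain ⟨⟨v, rfl⟩, A, B, C, -, hAC, hBC, hv⟩ := hs J hJ
  have hwv : ∀ i j, rankMat w i j ≤ rankMat v i j := rankMat_le_of_Jsym_le K w
    (hsum ▸ Finset.le_sup (f := fun J => J) hJ)
  -- `R(w') ≤ R(v)` must fail somewhere; since `R(w) ≤ R(v)`, it can only fail at the raised box,
  -- and there by exactly one.
  have hvij : rankMat v i j = rankMat w i j := by
    rw [Jsym_le_ker_genericPoint_iff] at hJnot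
    push Not at hJnot
    obtain ⟨i', j', hlt⟩ := hJnot
    have := hwv i' j'
    by_cases heq : (i', j') = (i, j)
    · simp only [Prod.mk.injEq] at heq
      obtain ⟨rfl, rfl⟩ := heq
      omega
    · have := hw'le i' j' heq
      omega
  refine hJnot ?_
  rw [hv, ciIdeal, minorIdeal_le_ker_evalSym]
  refine minorIdeal_eq_bot_of_boxes (genericPoint_isSymm K w') fun a ha b hb => ?_
  obtain ⟨i', j', hrank, hC, hcase⟩ := exists_box_of_Jsym_eq_ciIdeal hAC hBC hv ha hb
  refine ⟨i', j', ?_, hC, hcase⟩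
  rw [minorIdeal_genericPoint_eq_bot_iff, Nat.lt_succ_iff, ← hrank]
  refine (hw'le i' j' ?_).trans (hwv i' j')
  intro heq
  simp only [Prod.mk.injEq] at heq
  obtain ⟨rfl, rfl⟩ := heq
  -- If the box were `(i, j)`, then `R(w)` would take its least value `i + 1 - j` there, against the
  -- failure of both conditions.
  have hcard := congrArg Finset.card hC
  rw [Fin.card_Icc] at hcard
  omega

end Converse

end SymSchubert

theorem mainTheorem7 {K : Type*} [Field K] {n : ℕ} (w : Equiv.Perm (Fin n)) :
    SymSchubert.IsSumOfSchubertCI (SymSchubert.Jsym K w) ↔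
      SymSchubert.DefinedByInclusions w :=
  ⟨SymSchubert.definedByInclusions_of_isSumOfSchubertCI,
    SymSchubert.isSumOfSchubertCI_of_definedByInclusions K w⟩
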